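/- For a compact set $K\subset\mathbb{C}$ let $\gamma_K=\inf_\nu\iint\log\frac{1}{|z-w|}\,d\nu(z)\,d\nu(w)\in(-\infty,+\infty]$, the infimum being over all Borel probability measures $\nu$ supported on $K$, and let $\operatorname{Cap}(K)=e^{-\gamma_K}$ be the logarithmic capacity of $K$ (so that $\operatorname{Cap}(K)=0$ if $\gamma_K=+\infty$). Let $F\subset\mathbb{C}$ be a compact set with $\operatorname{Cap}(F)>0$. Then there exists a Borel probability measure $\mu$ supported in $F$ such that the logarithmic potential $$U_\mu(z)=\int\log\frac{1}{|z-w|}\,d\mu(w)$$ is finite for every $z\in\mathbb{C}$ and is a continuous function of $z$ on all of $\mathbb{C}$. -/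

import Mathlib

open MeasureTheory
open scoped ENNReal

noncomputable section

/-- The logarithmic kernel `log (1 / |z - w|)`, with its usual value `+∞` on the diagonal. -/
def logKernel (z w : ℂ) : EReal :=
  if z = w then ⊤ else ((Real.log (1 / ‖z - w‖) : ℝ) : EReal)

/-- The Lebesgue integral of an extended real valued function, as the integral of the positive part
minus the integral of the negative part. It is used where the latter is finite; its value is a real
number exactly if both integrals are finite. -/
def erealIntegral {α : Type*} [MeasurableSpace α] (μ : Measure α) (f : α → EReal) : EReal :=
  ((∫⁻ x, (f x).toENNReal ∂μ : ℝ≥0∞) : EReal) - ((∫⁻ x, (-f x).toENNReal ∂μ : ℝ≥0∞) : EReal)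

/-- The logarithmic potential `U_μ(z) = ∫ log (1 / |z - w|) dμ(w)` of a compactly supported finite
measure `μ`, with values in `(-∞, +∞]`. -/
def logPotential (μ : Measure ℂ) (z : ℂ) : EReal :=
  erealIntegral μ (fun w => logKernel z w)

/-- The logarithmic energy `∫ ∫ log (1 / |z - w|) dμ(w) dμ(z)` of a compactly supported finite
measure `μ`, with values in `(-∞, +∞]`. -/
def logEnergy (μ : Measure ℂ) : EReal :=
  erealIntegral μ (fun z => logPotential μ z)

/-- The Robin constant of a compact set `K`: the infimum of the energies of the Borel probability
measures supported on `K` (it is `+∞` if `K` is empty). -/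
def robinConstant (K : Set ℂ) : EReal :=
  ⨅ (μ : Measure ℂ) (_ : IsProbabilityMeasure μ) (_ : μ Kᶜ = 0), logEnergy μ

/-- The logarithmic capacity `e ^ (-γ)` of a compact set `K`, where `γ` is its Robin constant;
`e ^ (-∞) = 0`. -/
def logCapacity (K : Set ℂ) : ℝ≥0∞ :=
  EReal.exp (-robinConstant K)

end

open Filter Topology

/-! Positive capacity gives a probability measure `ν` of finite energy, whose potential is finite
`ν`-a.e., so its truncation tails `logTail ν n` decrease to 0 a.e. Egorov's theorem makes this
uniform on a compact `E` with `ν E ≠ 0` (`exists_isCompact_logTail_le`). Conditioning `ν` on `E`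
keeps the tails uniformly small on `E`, and comparison with a nearest point of `E` extends this to
the plane (`logTail_succ_le`). The potential is then a uniform limit of continuous truncated
potentials. -/

lemma logKernel_eq_neg_log (z w : ℂ) : logKernel z w = -ENNReal.log ‖z - w‖ₑ := by
  unfold logKernel
  split_ifs with h
  · simp [h]
  · have h0 : 0 < ‖z - w‖ := norm_pos_iff.2 (sub_ne_zero.2 h)
    rw [← ofReal_norm, ENNReal.log_ofReal_of_pos h0, one_div, Real.log_inv,
      EReal.coe_neg]

lemma continuous_logKernel : Continuous fun p : ℂ × ℂ => logKernel p.1 p.2 := by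
  simp_rw [logKernel_eq_neg_log]
  exact continuous_neg.comp (ENNReal.continuous_log.comp
    (continuous_fst.sub continuous_snd).enorm)

lemma neg_logKernel_ne_top (z w : ℂ) : -logKernel z w ≠ ⊤ := by
  rw [logKernel_eq_neg_log, neg_neg, Ne, ENNReal.log_eq_top_iff]
  exact enorm_ne_top

/-- The positive part of the logarithmic kernel. -/
noncomputable def logKernelPos (z w : ℂ) : ℝ≥0∞ := (logKernel z w).toENNReal

/-- The negative part of the logarithmic kernel. -/
noncomputable def logKernelNeg (z w : ℂ) : ℝ≥0∞ := (-logKernel z w).toENNReal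

lemma logPotential_eq (μ : Measure ℂ) (z : ℂ) :
    logPotential μ z = ((∫⁻ w, logKernelPos z w ∂μ : ℝ≥0∞) : EReal) -
      ((∫⁻ w, logKernelNeg z w ∂μ : ℝ≥0∞) : EReal) := rfl

lemma continuous_logKernelPos : Continuous fun p : ℂ × ℂ => logKernelPos p.1 p.2 :=
  continuous_logKernel.ereal_toENNReal

lemma continuous_logKernelNeg : Continuous fun p : ℂ × ℂ => logKernelNeg p.1 p.2 :=
  (continuous_neg.comp continuous_logKernel).ereal_toENNReal

lemma logKernelNeg_ne_top (z w : ℂ) : logKernelNeg z w ≠ ⊤ :=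
  EReal.toENNReal_ne_top_iff.2 (neg_logKernel_ne_top z w)

lemma measurable_logKernelPos (z : ℂ) : Measurable (logKernelPos z) :=
  (continuous_logKernelPos.comp (Continuous.prodMk_right z)).measurable

/-- The loss is at most `log 2`; rounding it up to 1 keeps truncation levels integral. -/
lemma logKernelPos_le_add_one {z z' w : ℂ} (h : ‖z' - w‖ ≤ 2 * ‖z - w‖) :
    logKernelPos z w ≤ logKernelPos z' w + 1 := by
  unfold logKernelPos logKernel
  by_cases h' : z' = w
  · simp [h']
  have hpos' : 0 < ‖z' - w‖ := norm_pos_iff.2 (sub_ne_zero.2 h')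
  have hpos : 0 < ‖z - w‖ := by linarith
  have hne : z ≠ w := sub_ne_zero.1 (norm_pos_iff.1 hpos)
  rw [if_neg h', if_neg hne, EReal.real_coe_toENNReal, EReal.real_coe_toENNReal,
    ← ENNReal.ofReal_one]
  refine (ENNReal.ofReal_le_ofReal ?_).trans ENNReal.ofReal_add_le
  have h1 := Real.log_le_log hpos' h
  rw [Real.log_mul two_ne_zero hpos.ne'] at h1
  have h2 : Real.log 2 < 1 := Real.log_two_lt_d9.trans (by norm_num)
  rw [one_div, one_div, Real.log_inv, Real.log_inv]
  linarith

section Parametric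

variable {μ : Measure ℂ} [IsFiniteMeasure μ] {E : Set ℂ} {f : ℂ × ℂ → ℝ≥0∞}

lemma lintegral_ne_top_of_continuous_of_isCompact (hE : IsCompact E) (hμ : μ Eᶜ = 0)
    {g : ℂ → ℝ≥0∞} (hg : Continuous g) (hfin : ∀ w, g w ≠ ⊤) : ∫⁻ w, g w ∂μ ≠ ⊤ := by
  obtain ⟨M, hM⟩ := hE.bddAbove_image
    (ENNReal.continuousOn_toReal.comp hg.continuousOn fun w _ => hfin w)
  have hae : ∀ᵐ w ∂μ, g w ≤ ENNReal.ofReal M := by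
    filter_upwards [mem_ae_iff.2 hμ] with w hw
    rw [← ENNReal.ofReal_toReal (hfin w)]
    exact ENNReal.ofReal_le_ofReal (hM (Set.mem_image_of_mem _ hw))
  refine ne_top_of_le_ne_top ?_ (lintegral_mono_ae hae)
  rw [lintegral_const]
  exact ENNReal.mul_ne_top ENNReal.ofReal_ne_top (measure_ne_top _ _)

lemma continuous_toReal_lintegral (hE : IsCompact E) (hμ : μ Eᶜ = 0)
    (hf : Continuous f) (hfin : ∀ p, f p ≠ ⊤) :
    Continuous fun z => (∫⁻ w, f (z, w) ∂μ).toReal := by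
  have hc : Continuous fun p => (f p).toReal :=
    ENNReal.continuousOn_toReal.comp_continuous hf hfin
  have hr : μ.restrict E = μ := Measure.restrict_eq_self_of_ae_mem (mem_ae_iff.2 hμ)
  have h := continuous_parametric_integral_of_continuous (μ := μ)
    (f := fun z w => (f (z, w)).toReal) hc hE
  rw [hr] at h
  convert h using 2 with z
  exact (integral_toReal (hf.comp (Continuous.prodMk_right z)).measurable.aemeasurable
    (ae_of_all _ fun w => (hfin _).lt_top)).symm

end Parametric

/-- The part of the logarithmic potential coming from the values of the kernel above `n`. -/
noncomputable def logTail (μ : Measure ℂ) (n : ℕ) (z : ℂ) : ℝ≥0∞ := ∫⁻ w, (logKernelPos z w - n) ∂μ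

lemma logTail_antitone (μ : Measure ℂ) (z : ℂ) : Antitone fun n => logTail μ n z :=
  fun m n h => lintegral_mono fun w => tsub_le_tsub_left (by exact_mod_cast h) _

lemma measurable_logTail (μ : Measure ℂ) [SFinite μ] (n : ℕ) : Measurable (logTail μ n) :=
  (continuous_logKernelPos.measurable.sub_const (n : ℝ≥0∞)).lintegral_prod_right'

lemma logTail_zero (μ : Measure ℂ) (z : ℂ) : logTail μ 0 z = ∫⁻ w, logKernelPos z w ∂μ := by
  simp [logTail]

lemma tendsto_logTail {μ : Measure ℂ} {z : ℂ} (h : logTail μ 0 z ≠ ⊤) :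
    Tendsto (fun n => logTail μ n z) atTop (𝓝 0) := by
  have hfin := h
  rw [logTail_zero] at hfin
  rw [← lintegral_zero (μ := μ)]
  refine lintegral_tendsto_of_tendsto_of_antitone
    (fun n => ((measurable_logKernelPos z).sub_const _).aemeasurable)
    (ae_of_all _ fun w m n hmn => tsub_le_tsub_left (by exact_mod_cast hmn) _) h ?_
  filter_upwards [ae_lt_top (measurable_logKernelPos z) hfin] with w hw
  obtain ⟨N, hN⟩ := ENNReal.exists_nat_gt hw.ne
  refine tendsto_const_nhds.congr' ?_
  filter_upwards [eventually_ge_atTop N] with n hn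
  exact (tsub_eq_zero_of_le (hN.le.trans (by exact_mod_cast hn))).symm

lemma lintegral_logKernelPos_eq (μ : Measure ℂ) (n : ℕ) (z : ℂ) :
    ∫⁻ w, logKernelPos z w ∂μ = ∫⁻ w, min (logKernelPos z w) n ∂μ + logTail μ n z := by
  unfold logTail
  rw [← lintegral_add_left ((measurable_logKernelPos z).min measurable_const)]
  refine lintegral_congr fun w => ?_
  rw [add_comm, tsub_add_min]

/-- A uniform bound of the tails on the support propagates to the plane. -/
lemma logTail_succ_le {μ : Measure ℂ} {E : Set ℂ} (hE : IsCompact E) (hne : E.Nonempty)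
    (hμ : μ Eᶜ = 0) {n : ℕ} {ε : ℝ≥0∞} (h : ∀ z ∈ E, logTail μ n z ≤ ε) (z : ℂ) :
    logTail μ (n + 1) z ≤ ε := by
  -- For `w ∈ E`, minimality of `z'` gives `|z' - w| ≤ |z' - z| + |z - w| ≤ 2 |z - w|`.
  obtain ⟨z', hz', hd⟩ := hE.exists_infDist_eq_dist hne z
  refine le_trans (lintegral_mono_ae ?_) (h z' hz')
  filter_upwards [mem_ae_iff.2 hμ] with w hw
  have h1 : dist z z' ≤ dist z w := hd ▸ Metric.infDist_le_dist_of_mem hw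
  have h2 := dist_triangle_left z' w z
  have h3 := logKernelPos_le_add_one (z := z) (z' := z') (w := w) (by
    rw [← dist_eq_norm, ← dist_eq_norm]; linarith)
  push_cast
  rw [add_comm, ← tsub_tsub]
  exact tsub_le_tsub_right (tsub_le_iff_right.2 h3) _

/-- If the tails of the potential of `μ` are uniformly small on a compact set carrying `μ`, the
potential is finite and continuous. -/
lemma exists_continuous_eq_logPotential {μ : Measure ℂ} [IsFiniteMeasure μ] {E : Set ℂ}
    (hE : IsCompact E) (hne : E.Nonempty) (hμ : μ Eᶜ = 0)
    (h : ∀ ε : ℝ≥0∞, ε ≠ 0 → ∃ n, ∀ z ∈ E, logTail μ n z ≤ ε) :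
    ∃ u : ℂ → ℝ, Continuous u ∧ ∀ z, logPotential μ z = ((u z : ℝ) : EReal) := by
  have h' : ∀ ε : ℝ≥0∞, ε ≠ 0 → ∃ n, ∀ z, logTail μ n z ≤ ε := fun ε hε => by
    obtain ⟨n, hn⟩ := h ε hε
    exact ⟨n + 1, logTail_succ_le hE hne hμ hn⟩
  have hcmin : ∀ n : ℕ, Continuous fun p : ℂ × ℂ => min (logKernelPos p.1 p.2) (n : ℝ≥0∞) :=
    fun n => continuous_logKernelPos.min continuous_const
  have hmin : ∀ (n : ℕ) (p : ℂ × ℂ), min (logKernelPos p.1 p.2) (n : ℝ≥0∞) ≠ ⊤ :=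
    fun n p => ne_top_of_le_ne_top (ENNReal.natCast_ne_top n) (min_le_right _ _)
  have hminint : ∀ (n : ℕ) (z : ℂ), ∫⁻ w, min (logKernelPos z w) (n : ℝ≥0∞) ∂μ ≠ ⊤ :=
    fun n z => lintegral_ne_top_of_continuous_of_isCompact hE hμ
      ((hcmin n).comp (Continuous.prodMk_right z)) fun w => hmin n (z, w)
  have hposfin : ∀ z, ∫⁻ w, logKernelPos z w ∂μ ≠ ⊤ := fun z => by
    obtain ⟨n, hn⟩ := h' 1 one_ne_zero
    rw [lintegral_logKernelPos_eq μ n]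
    exact ENNReal.add_ne_top.2 ⟨hminint n z, ne_top_of_le_ne_top ENNReal.one_ne_top (hn z)⟩
  have hnegfin : ∀ z, ∫⁻ w, logKernelNeg z w ∂μ ≠ ⊤ := fun z =>
    lintegral_ne_top_of_continuous_of_isCompact hE hμ
      (continuous_logKernelNeg.comp (Continuous.prodMk_right z)) (logKernelNeg_ne_top z)
  have hposcont : Continuous fun z => (∫⁻ w, logKernelPos z w ∂μ).toReal := by
    refine continuous_of_uniform_approx_of_continuous fun s hs => ?_
    obtain ⟨ε, hε, hs⟩ := Metric.mem_uniformity_dist.1 hs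
    obtain ⟨n, hn⟩ := h' (ENNReal.ofReal (ε / 2)) (by simpa using hε)
    refine ⟨fun z => (∫⁻ w, min (logKernelPos z w) n ∂μ).toReal,
      continuous_toReal_lintegral hE hμ (hcmin n) (hmin n), fun z => hs ?_⟩
    have ht : logTail μ n z ≠ ⊤ := ne_top_of_le_ne_top ENNReal.ofReal_ne_top (hn z)
    rw [lintegral_logKernelPos_eq μ n, ENNReal.toReal_add (hminint n z) ht, Real.dist_eq,
      add_sub_cancel_left, abs_of_nonneg ENNReal.toReal_nonneg]
    have := ENNReal.toReal_le_of_le_ofReal (by positivity) (hn z)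
    linarith
  refine ⟨_, hposcont.sub (continuous_toReal_lintegral hE hμ continuous_logKernelNeg
    fun p => logKernelNeg_ne_top p.1 p.2), fun z => ?_⟩
  rw [logPotential_eq, Pi.sub_apply, EReal.coe_sub, EReal.coe_ennreal_toReal (hposfin z),
    EReal.coe_ennreal_toReal (hnegfin z)]

/-- The potential of a measure of finite energy is finite almost everywhere. -/
lemma ae_lintegral_logKernelPos_ne_top {μ : Measure ℂ} [IsFiniteMeasure μ] {F : Set ℂ}
    (hF : IsCompact F) (hμ : μ Fᶜ = 0) (hen : logEnergy μ ≠ ⊤) :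
    ∀ᵐ z ∂μ, ∫⁻ w, logKernelPos z w ∂μ ≠ ⊤ := by
  have hnegfin : ∀ z, ∫⁻ w, logKernelNeg z w ∂μ ≠ ⊤ := fun z =>
    lintegral_ne_top_of_continuous_of_isCompact hF hμ
      (continuous_logKernelNeg.comp (Continuous.prodMk_right z)) (logKernelNeg_ne_top z)
  have hnegcont : Continuous fun z => ∫⁻ w, logKernelNeg z w ∂μ := by
    have := ENNReal.continuous_ofReal.comp (continuous_toReal_lintegral hF hμ
      continuous_logKernelNeg fun p => logKernelNeg_ne_top p.1 p.2)
    simpa [Function.comp_def, ENNReal.ofReal_toReal, hnegfin] using this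
  have hmeas : Measurable fun z => logPotential μ z := by
    have hpos : Measurable fun z => ∫⁻ w, logKernelPos z w ∂μ :=
      continuous_logKernelPos.measurable.lintegral_prod_right'
    simp_rw [logPotential_eq, sub_eq_add_neg]
    exact hpos.coe_ereal_ennreal.add hnegcont.measurable.coe_ereal_ennreal.neg
  have hneg : ∫⁻ z, (-logPotential μ z).toENNReal ∂μ ≠ ⊤ := by
    refine ne_top_of_le_ne_top
      (lintegral_ne_top_of_continuous_of_isCompact hF hμ hnegcont hnegfin)
      (lintegral_mono fun z => ?_)
    rw [← EReal.toENNReal_coe (x := ∫⁻ w, logKernelNeg z w ∂μ)]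
    refine EReal.toENNReal_le_toENNReal (EReal.neg_le.1 ?_)
    rw [logPotential_eq, sub_eq_add_neg]
    exact le_add_of_nonneg_left (EReal.coe_ennreal_nonneg _)
  -- Since `⊤ - ⊤ = ⊥` in `EReal`, an infinite positive part forces energy `⊤` only because the
  -- negative part is finite.
  have hpos : ∫⁻ z, (logPotential μ z).toENNReal ∂μ ≠ ⊤ := fun h => hen <| by
    unfold logEnergy erealIntegral
    rw [h, EReal.coe_ennreal_top, EReal.top_sub]
    simpa using hneg
  filter_upwards [ae_lt_top hmeas.ereal_toENNReal hpos] with z hz htop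
  rw [logPotential_eq, htop, EReal.coe_ennreal_top, EReal.top_sub (by simpa using hnegfin z)] at hz
  simp at hz

lemma exists_logEnergy_ne_top {K : Set ℂ} (h : 0 < logCapacity K) :
    ∃ μ : Measure ℂ, IsProbabilityMeasure μ ∧ μ Kᶜ = 0 ∧ logEnergy μ ≠ ⊤ := by
  by_contra! hcon
  have : robinConstant K = ⊤ := by
    simp only [robinConstant, iInf_eq_top]
    exact hcon
  simp [logCapacity, this] at h

/-- Egorov's theorem for the tails of the potential. -/
lemma exists_isCompact_logTail_le {μ : Measure ℂ} [IsProbabilityMeasure μ] {F : Set ℂ}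
    (hF : IsCompact F) (hμ : μ Fᶜ = 0) (hfin : ∀ᵐ z ∂μ, ∫⁻ w, logKernelPos z w ∂μ ≠ ⊤) :
    ∃ E ⊆ F, IsCompact E ∧ μ E ≠ 0 ∧
      ∀ ε : ℝ≥0∞, ε ≠ 0 → ∃ n, ∀ z ∈ E, logTail μ n z ≤ ε := by
  simp_rw [← logTail_zero] at hfin
  obtain ⟨t, htm, htμ, ht⟩ := tendstoUniformlyOn_of_ae_tendsto' (μ := μ)
    (f := fun n z => (logTail μ n z).toReal) (g := fun _ => (0 : ℝ)) (ε := 1 / 2)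
    (fun n => (measurable_logTail μ n).ennreal_toReal.stronglyMeasurable)
    stronglyMeasurable_const
    (by
      filter_upwards [hfin] with z hz
      simpa [Function.comp_def] using (ENNReal.tendsto_toReal ENNReal.zero_ne_top).comp (tendsto_logTail hz))
    (by norm_num)
  -- `toReal` sends `⊤` to 0, so infinite tails must be excluded before uniform convergence of the
  -- real values says anything.
  set S : Set ℂ := F ∩ {z | logTail μ 0 z ≠ ⊤}
  have hSm : MeasurableSet S :=
    hF.measurableSet.inter (measurable_logTail μ 0 (measurableSet_singleton ⊤).compl)
  have hS : S ∈ ae μ := inter_mem (mem_ae_iff.2 hμ) hfin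
  -- `S` has mass 1 and the exceptional set `t` at most 1/2.
  have hpos : μ (S \ t) ≠ 0 := fun h0 => by
    have h1 : μ S ≤ μ (S \ t) + μ t := (measure_mono (by
      rw [Set.sdiff_union_self]; exact Set.subset_union_left)).trans (measure_union_le _ _)
    rw [(prob_compl_eq_zero_iff hSm).1 (mem_ae_iff.1 hS), h0, zero_add] at h1
    have h2 := h1.trans htμ
    rw [← ENNReal.ofReal_one, ENNReal.ofReal_le_ofReal_iff (by norm_num)] at h2
    norm_num at h2
  obtain ⟨E, hES, hE, hE0⟩ :=
    (hSm.diff htm).exists_lt_isCompact (μ := μ) (pos_iff_ne_zero.2 hpos)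
  refine ⟨E, fun z hz => (hES hz).1.1, hE, hE0.ne', fun ε hε => ?_⟩
  rcases eq_or_ne ε ⊤ with rfl | hε'
  · exact ⟨0, fun _ _ => le_top⟩
  obtain ⟨n, hn⟩ := (Metric.tendstoUniformlyOn_iff.1 ht ε.toReal
    (ENNReal.toReal_pos hε hε')).exists
  refine ⟨n, fun z hz => ?_⟩
  have hzfin : logTail μ n z ≠ ⊤ :=
    ne_top_of_le_ne_top (hES hz).1.2 (logTail_antitone μ z (Nat.zero_le n))
  have := hn z (hES hz).2
  rw [dist_comm, Real.dist_0_eq_abs, abs_of_nonneg ENNReal.toReal_nonneg] at this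
  exact ((ENNReal.toReal_le_toReal hzfin hε').1 this.le)

theorem lemma5 (F : Set ℂ) (hF : IsCompact F) (hcap : 0 < logCapacity F) :
    ∃ μ : Measure ℂ, IsProbabilityMeasure μ ∧ μ Fᶜ = 0 ∧
      ∃ u : ℂ → ℝ, Continuous u ∧ ∀ z : ℂ, logPotential μ z = ((u z : ℝ) : EReal) := by
  obtain ⟨ν, hν, hνF, hen⟩ := exists_logEnergy_ne_top hcap
  obtain ⟨E, hEF, hE, hE0, htail⟩ := exists_isCompact_logTail_le hF hνF
    (ae_lintegral_logKernelPos_ne_top hF hνF hen)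
  have hprob : IsProbabilityMeasure (ProbabilityTheory.cond ν E) :=
    ProbabilityTheory.cond_isProbabilityMeasure hE0
  have hμE : ProbabilityTheory.cond ν E Eᶜ = 0 := by
    rw [ProbabilityTheory.cond_apply hE.measurableSet]; simp
  refine ⟨ProbabilityTheory.cond ν E, hprob,
    measure_mono_null (Set.compl_subset_compl.2 hEF) hμE,
    exists_continuous_eq_logPotential hE (nonempty_of_measure_ne_zero hE0) hμE fun ε hε => ?_⟩
  -- The factor `ν E` cancels the normalisation `(ν E)⁻¹` of the conditioned measure.
  obtain ⟨n, hn⟩ := htail (ν E * ε) (mul_ne_zero hE0 hε)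
  refine ⟨n, fun z hz => ?_⟩
  calc logTail (ProbabilityTheory.cond ν E) n z
      = (ν E)⁻¹ * ∫⁻ w in E, (logKernelPos z w - n) ∂ν := lintegral_smul_measure _ _
    _ ≤ (ν E)⁻¹ * (ν E * ε) := by
        gcongr
        exact (setLIntegral_le_lintegral _ _).trans (hn z hz)
    _ = ε := by
        rw [← mul_assoc, ENNReal.inv_mul_cancel hE0 (measure_ne_top _ _), one_mul]
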